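/- Write $[n]=\frac{1-q^n}{1-q}$, $[n]!=[n][n-1]\cdots[1]$, and $C_{m,n}(q)=\frac{1}{[n+m]}\cdot\frac{[m+n]!}{[m]!\,[n]!}\in\mathbb{Q}(q)$. For a rational function $f(q)$ of degree $\delta$ (degree of the numerator minus degree of the denominator) let $\mathcal{N}f(q)=f(q^2)q^{-\delta}$, with $\mathcal{N}0=0$. Let $$F_5(x,q)=\sum_{n\ge 0}(q^2-q^{-2})\,\mathcal{N}C_{5,n}(q)\,x^n\in\mathbb{Q}((q))[[x]].$$ For a series in $\mathbb{Q}((q))[[x]]$ let $\mathrm{PT}$ extract, coefficientwise in $x$, the terms with positive exponent in $q$, let $\mathrm{NT}$ extract those with negative exponent in $q$, and put $\mathrm{PT}'F(x,q)=-\mathrm{NT}F(x,q)\big|_{q=q^{-1}}$. Let $X_{5,r}\sum_n a_n(q)x^n=\sum_{k\ge0}a_{5k+r}(q)x^k$. A polynomial $a_0+a_1q+\cdots+a_nq^n$ of degree $n$ is unimodal with respect to parity if both sequences $a_0,a_2,a_4,\dots$ and $a_1,a_3,a_5,\dots$ of its coefficients are unimodal. Proposition 9. (a) Let $0\le r\le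 4$, $d=\gcd(5,r)$ (so $d=5$ if $r=0$ and $d=1$ otherwise), and $H=\frac{q^d-q^{-d}}{q-q^{-1}}F_5(x,q)$. Then $\mathrm{PT}\,X_{5,r}H=X_{5,r}\,\mathrm{PT}\,H$, this series is also equal to $\mathrm{PT}'X_{5,r}H=X_{5,r}\,\mathrm{PT}'H$, and it is a power series in $x$ with coefficients in $\mathbb{N}[q]$. (b) Consequently, for every $n\ge1$, $[\gcd(5,n)]\,C_{5,n}(q)$ is a polynomial in $\mathbb{N}[q]$ that is unimodal with respect to parity. In particular, for every $n\ge 1$ coprime to $5$, $C_{5,n}(q)$ is a polynomial in $\mathbb{N}[q]$ that is unimodal with respect to parity. -/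

import Mathlib

open scoped Polynomial PowerSeries LaurentSeries

noncomputable section

namespace QCatalan

/-! ### `q`-Catalan rational functions, as elements of `ℚ(q)` -/

/-- The variable `q` of the field `ℚ(q)`. -/
def q : RatFunc ℚ := RatFunc.X

/-- The `q`-number `[n] = (1 - q ^ n) / (1 - q)`. -/
def qNum (n : ℕ) : RatFunc ℚ := (1 - q ^ n) / (1 - q)

/-- The `q`-factorial `[n]! = [n] [n - 1] ⋯ [1]`. -/
def qFact (n : ℕ) : RatFunc ℚ := ∏ i ∈ Finset.Icc 1 n, qNum i

/-- The Gaussian binomial coefficient with top entry `a + b` and bottom entry `b`,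
that is, `[a + b]! / ([a]! [b]!)`. -/
def gauss (a b : ℕ) : RatFunc ℚ := qFact (a + b) / (qFact a * qFact b)

/-- The rational `q`-Catalan function `C_{m,n}(q)`, the quotient by `[n + m]` of the Gaussian
binomial coefficient with top entry `m + n` and bottom entry `n`. -/
def ratCatalan (m n : ℕ) : RatFunc ℚ := 1 / qNum (n + m) * gauss m n

/-- The normalization `f(q ^ 2) q ^ (-deg f)`. On polynomials `deg` is the usual degree; on
rational functions it is the degree of the numerator minus that of the denominator. -/
def normalization (f : RatFunc ℚ) : RatFunc ℚ :=
  RatFunc.eval (RatFunc.C : ℚ →+* RatFunc ℚ) (q ^ 2) f * q ^ (-f.intDegree)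

/-! ### Power series in `x` with coefficients in `ℚ((q))` -/

/-- The expansion of a rational function as a Laurent series, `ℚ(q) → ℚ((q))`. -/
def expansion (f : RatFunc ℚ) : ℚ⸨X⸩ := (f : ℚ⸨X⸩)

/-- The generating function
`F_m(x, q) = ∑_{n ≥ 0} (q ^ 2 - q ^ (-2)) (normalization of C_{m,n}(q)) x ^ n` in
`ℚ((q))[[x]]`. -/
def genF (m : ℕ) : PowerSeries ℚ⸨X⸩ :=
  PowerSeries.mk fun n => expansion ((q ^ 2 - q ^ (-2 : ℤ)) * normalization (ratCatalan m n))

/-- The factor `(q ^ d - q ^ (-d)) / (q - q ^ (-1))`. -/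
def symNum (d : ℕ) : RatFunc ℚ := (q ^ d - q ^ (-(d : ℤ))) / (q - q ^ (-1 : ℤ))

/-- The series `(q ^ d - q ^ (-d)) / (q - q ^ (-1)) * F_m(x, q)`. -/
def genH (m d : ℕ) : PowerSeries ℚ⸨X⸩ := PowerSeries.C (expansion (symNum d)) * genF m

/-- The operator `X_{m,r}`, which sends `∑ a_n x ^ n` to `∑ a_{km+r} x ^ k`. -/
def extract (m r : ℕ) (G : PowerSeries ℚ⸨X⸩) : PowerSeries ℚ⸨X⸩ :=
  PowerSeries.mk fun k => PowerSeries.coeff (k * m + r) G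

/-- The terms with positive exponent of a Laurent series. -/
def posPart (f : ℚ⸨X⸩) : ℚ⸨X⸩ where
  coeff i := if 0 < i then f.coeff i else 0
  isPWO_support' := f.isPWO_support.mono fun i hi => by
    simp only [Function.mem_support, ne_eq, ite_eq_right_iff, Classical.not_imp] at hi
    exact hi.2

/-- The negative of the terms with negative exponent of a Laurent series, with `q` replaced by
`q ^ (-1)`: the coefficient of `q ^ i` is minus the coefficient of `q ^ (-i)` in `f` for `i > 0`,
and `0` otherwise. -/
def posPart' (f : ℚ⸨X⸩) : ℚ⸨X⸩ where
  coeff i := if 0 < i then -f.coeff (-i) else 0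
  isPWO_support' := by
    refine Set.Finite.isPWO ((Set.finite_Icc (0 : ℤ) (-f.order)).subset fun i hi => ?_)
    simp only [Function.mem_support, ne_eq, ite_eq_right_iff, Classical.not_imp, neg_eq_zero] at hi
    have h := HahnSeries.order_le_of_coeff_ne_zero hi.2
    exact ⟨hi.1.le, by omega⟩

/-- `PT_q`, acting coefficientwise in `x`. -/
def PT (G : PowerSeries ℚ⸨X⸩) : PowerSeries ℚ⸨X⸩ :=
  PowerSeries.mk fun n => posPart (PowerSeries.coeff n G)

/-- `PT'_q`, acting coefficientwise in `x`. -/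
def PT' (G : PowerSeries ℚ⸨X⸩) : PowerSeries ℚ⸨X⸩ :=
  PowerSeries.mk fun n => posPart' (PowerSeries.coeff n G)

/-- A polynomial in `q` with natural number coefficients as a rational function. -/
def ofNatPoly (p : ℕ[X]) : RatFunc ℚ :=
  algebraMap ℚ[X] (RatFunc ℚ) (p.map (Nat.castRingHom ℚ))

/-- All coefficients (in `x`) of the series lie in `ℕ[q]`. -/
def HasNatPolyCoeffs (G : PowerSeries ℚ⸨X⸩) : Prop :=
  ∀ k, ∃ p : ℕ[X], PowerSeries.coeff k G = expansion (ofNatPoly p)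

/-! ### Unimodality -/

/-- The finite sequence `a 0, …, a (N - 1)` of `N` terms is unimodal. -/
def IsUnimodalSeq (a : ℕ → ℕ) (N : ℕ) : Prop :=
  ∃ k, ∀ i, i + 1 < N → (i < k → a i ≤ a (i + 1)) ∧ (k ≤ i → a (i + 1) ≤ a i)

/-- A polynomial `a_0 + a_1 q + ⋯ + a_n q ^ n` of degree `n` is unimodal with respect to parity:
the sequence `a_0, a_2, …` of its `n / 2 + 1` coefficients of even index and the sequence
`a_1, a_3, …` of its `(n + 1) / 2` coefficients of odd index are both unimodal. -/
def IsParityUnimodal (p : ℕ[X]) : Prop :=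
  IsUnimodalSeq (fun i => p.coeff (2 * i)) (p.natDegree / 2 + 1) ∧
    IsUnimodalSeq (fun i => p.coeff (2 * i + 1)) ((p.natDegree + 1) / 2)

end QCatalan

end

/-! Cancelling factorials gives `C_{5,n} = ∏_{i=1}^4 (1 - q^(n+i)) /
((1-q^2)(1-q^3)(1-q^4)(1-q^5))`. Four consecutive integers contain two even numbers, a multiple of
3, a multiple of 4 and, if `5 ∤ n`, a multiple of 5; comparing cyclotomic factors, the quotient is a
polynomial. If `5 ∣ n`, multiplying by `[5]` replaces `1 - q^5` by `1 - q`. In both cases the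
resulting `P` is palindromic of even degree `2h`.

Everything else reduces to `(1 - q^2) P` having coefficients in `ℕ` up to degree `h`. The factor `1
- q^2` cancels, leaving the generating function of partitions into parts 3, 4, 5 (or 1, 3, 4) times
the four numerator factors. Up to degree `h` only the linear terms of the numerator matter, so the
coefficient at `j` is a partition count at `j` minus four counts near `j - n`. It is nonnegative by
`sumFour_count345_le` and `sumFour_count134_le`, proved from quasi-periodicity and a finite check.

Palindromicity then gives (b). For (a), normalization is multiplicative, so the coefficients of
`X_{5,r} H` are centred versions of `((X^2 - 1) P)(q^2)`. These are antisymmetric under `q ↦ q⁻¹`,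
whence `PT = PT'`, and their positive half consists of the coefficients just shown to be in `ℕ`. -/

namespace QCatalan

/-! ### Counting partitions with parts in `{3, 4, 5}` and in `{1, 3, 4}` -/

/-- The number of partitions of `j` into parts `3` and `4`. -/
def count34 (j : ℕ) : ℕ := j / 12 + if j % 12 = 1 ∨ j % 12 = 2 ∨ j % 12 = 5 then 0 else 1

/-- The number of partitions of `j` into parts `3`, `4` and `5`. -/
def count345 (j : ℕ) : ℕ := ∑ i ∈ Finset.range (j / 5 + 1), count34 (j % 5 + 5 * i)

/-- The number of partitions of `j` into parts `1`, `3` and `4`. -/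
def count134 (j : ℕ) : ℕ := ∑ i ∈ Finset.range (j + 1), count34 i

/-- Either some part 4 is removed, or all parts are 3. This recursion ties the closed formula to the
generating function. -/
theorem count34_add_four (j : ℕ) :
    count34 (j + 4) = (if 3 ∣ j + 4 then 1 else 0) + count34 j := by
  have h : j % 12 < 12 := Nat.mod_lt _ (by norm_num)
  unfold count34
  split_ifs <;> omega

theorem count345_add_five (j : ℕ) : count345 (j + 5) = count34 (j + 5) + count345 j := by
  unfold count345
  rw [show (j + 5) / 5 + 1 = (j / 5 + 1) + 1 by omega, Finset.sum_range_succ,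
    show (j + 5) % 5 = j % 5 by omega, show j % 5 + 5 * (j / 5 + 1) = j + 5 by omega, add_comm]

theorem count134_add_one (j : ℕ) : count134 (j + 1) = count34 (j + 1) + count134 j := by
  unfold count134
  rw [Finset.sum_range_succ _ (j + 1), add_comm]

theorem count34_add_twelve (j : ℕ) : count34 (j + 12) = count34 j + 1 := by
  unfold count34
  rw [show (j + 12) / 12 = j / 12 + 1 by omega, show (j + 12) % 12 = j % 12 by omega]
  ring

/-- Raising `j` by 12 raises each of the twelve terms by 1, so only `j < 12` needs checking. -/
theorem sum_count34_add_five_mul (j : ℕ) :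
    ∑ i ∈ Finset.range 12, count34 (j + 5 * (i + 1)) = j + 36 := by
  induction j using Nat.strong_induction_on with
  | _ j ih =>
    rcases lt_or_ge j 12 with h | h
    · have : ∀ j < 12, ∑ i ∈ Finset.range 12, count34 (j + 5 * (i + 1)) = j + 36 := by
        decide +kernel
      exact this j h
    · obtain ⟨k, rfl⟩ := Nat.exists_eq_add_of_le' h
      have := ih k (by omega)
      simp_rw [show ∀ i, k + 12 + 5 * (i + 1) = k + 5 * (i + 1) + 12 by intro i; ring,
        count34_add_twelve, Finset.sum_add_distrib, this]
      simp

theorem count345_add_sixty (j : ℕ) : count345 (j + 60) = count345 j + (j + 36) := by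
  have h : ∀ m, count345 (j + 5 * m) =
      count345 j + ∑ i ∈ Finset.range m, count34 (j + 5 * (i + 1)) := by
    intro m
    induction m with
    | zero => simp
    | succ m ih =>
      rw [show j + 5 * (m + 1) = j + 5 * m + 5 by ring, count345_add_five, ih,
        Finset.sum_range_succ]
      ring_nf
  rw [← sum_count34_add_five_mul j]
  exact h 12

theorem sum_count34_add_range (j : ℕ) :
    ∑ i ∈ Finset.range 12, count34 (j + (i + 1)) = j + 10 := by
  induction j using Nat.strong_induction_on with
  | _ j ih =>
    rcases lt_or_ge j 12 with h | h
    · have : ∀ j < 12, ∑ i ∈ Finset.range 12, count34 (j + (i + 1)) = j + 10 := by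
        decide +kernel
      exact this j h
    · obtain ⟨k, rfl⟩ := Nat.exists_eq_add_of_le' h
      have := ih k (by omega)
      simp_rw [show ∀ i, k + 12 + (i + 1) = k + (i + 1) + 12 by intro i; ring,
        count34_add_twelve, Finset.sum_add_distrib, this]
      simp

theorem count134_add_twelve (j : ℕ) : count134 (j + 12) = count134 j + (j + 10) := by
  have h : ∀ m, count134 (j + m) =
      count134 j + ∑ i ∈ Finset.range m, count34 (j + (i + 1)) := by
    intro m
    induction m with
    | zero => simp
    | succ m ih =>
      rw [← add_assoc, count134_add_one, ih, Finset.sum_range_succ]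
      ring_nf
  rw [← sum_count34_add_range j]
  exact h 12

/-! ### Inequalities between partition counts -/

/-- The sequence `f` shifted by four places, with value `0` in the first four places. -/
def shiftFour (f : ℕ → ℕ) (m : ℕ) : ℕ := if m < 4 then 0 else f (m - 4)

theorem shiftFour_count345_add_sixty (m : ℕ) :
    shiftFour count345 (m + 60) = shiftFour count345 m + (m + 32) := by
  rcases lt_or_ge m 4 with h | h
  · have : ∀ m < 4, shiftFour count345 (m + 60) = shiftFour count345 m + (m + 32) := by
      decide +kernel
    exact this m h
  · obtain ⟨k, rfl⟩ := Nat.exists_eq_add_of_le' h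
    have h1 : ¬ k + 4 + 60 < 4 := by omega
    have h2 : ¬ k + 4 < 4 := by omega
    rw [shiftFour, shiftFour, if_neg h1, if_neg h2, show k + 4 + 60 - 4 = k + 60 by omega,
      show k + 4 - 4 = k by omega, count345_add_sixty]

theorem shiftFour_count134_add_twelve (m : ℕ) :
    shiftFour count134 (m + 12) = shiftFour count134 m + (m + 6) := by
  rcases lt_or_ge m 4 with h | h
  · have : ∀ m < 4, shiftFour count134 (m + 12) = shiftFour count134 m + (m + 6) := by
      decide +kernel
    exact this m h
  · obtain ⟨k, rfl⟩ := Nat.exists_eq_add_of_le' h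
    have h1 : ¬ k + 4 + 12 < 4 := by omega
    have h2 : ¬ k + 4 < 4 := by omega
    rw [shiftFour, shiftFour, if_neg h1, if_neg h2, show k + 4 + 12 - 4 = k + 12 by omega,
      show k + 4 - 4 = k by omega, count134_add_twelve]

/-- The sum of the four values of `f` preceding `f s`. -/
def sumFour (f : ℕ → ℕ) (s : ℕ) : ℕ := ∑ i ∈ Finset.range 4, shiftFour f (s + i)

theorem sumFour_count345_add_sixty (s : ℕ) :
    sumFour count345 (s + 60) = sumFour count345 s + (4 * s + 134) := by
  simp only [sumFour, Finset.sum_range_succ, Finset.sum_range_zero, add_right_comm s 60,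
    shiftFour_count345_add_sixty]
  ring

theorem sumFour_count134_add_twelve (s : ℕ) :
    sumFour count134 (s + 12) = sumFour count134 s + (4 * s + 30) := by
  simp only [sumFour, Finset.sum_range_succ, Finset.sum_range_zero, add_right_comm s 12,
    shiftFour_count134_add_twelve]
  ring

/-- Raising `s` by 60 adds `4s + 134` on the left and `4s + 136 + 2u` on the right; raising `u` by
60 only increases the right side. This leaves the square `s, u < 60`. -/
theorem sumFour_count345_le (s u : ℕ) : sumFour count345 s ≤ count345 (2 * s + 2 + u) := by
  induction s using Nat.strong_induction_on generalizing u with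
  | _ s ihs =>
    rcases lt_or_ge s 60 with hs | hs
    · induction u using Nat.strong_induction_on with
      | _ u ihu =>
        rcases lt_or_ge u 60 with hu | hu
        · have : ∀ s < 60, ∀ u < 60, sumFour count345 s ≤ count345 (2 * s + 2 + u) := by
            decide +kernel
          exact this s hs u hu
        · obtain ⟨k, rfl⟩ := Nat.exists_eq_add_of_le' hu
          have := ihu k (by omega)
          rw [← add_assoc, count345_add_sixty]
          omega
    · obtain ⟨k, rfl⟩ := Nat.exists_eq_add_of_le' hs
      have := ihs k (by omega) u
      rw [sumFour_count345_add_sixty,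
        show 2 * (k + 60) + 2 + u = 2 * k + 2 + u + 60 + 60 by ring,
        count345_add_sixty, count345_add_sixty]
      omega

theorem sumFour_count134_le (s u : ℕ) : sumFour count134 s ≤ count134 (2 * s + u) := by
  induction s using Nat.strong_induction_on generalizing u with
  | _ s ihs =>
    rcases lt_or_ge s 12 with hs | hs
    · induction u using Nat.strong_induction_on with
      | _ u ihu =>
        rcases lt_or_ge u 12 with hu | hu
        · have : ∀ s < 12, ∀ u < 12, sumFour count134 s ≤ count134 (2 * s + u) := by
            decide +kernel
          exact this s hs u hu
        · obtain ⟨k, rfl⟩ := Nat.exists_eq_add_of_le' hu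
          have := ihu k (by omega)
          rw [← add_assoc, count134_add_twelve]
          omega
    · obtain ⟨k, rfl⟩ := Nat.exists_eq_add_of_le' hs
      have := ihs k (by omega) u
      rw [sumFour_count134_add_twelve,
        show 2 * (k + 12) + u = 2 * k + u + 12 + 12 by ring,
        count134_add_twelve, count134_add_twelve]
      omega

/-! ### Generating functions -/

theorem one_sub_X_pow_mul_mk {k : ℕ} {f g : ℕ → ℚ}
    (h : ∀ j, f j = g j + if k ≤ j then f (j - k) else 0) :
    (1 - PowerSeries.X ^ k) * PowerSeries.mk f = PowerSeries.mk g := by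
  ext j
  rw [sub_mul, one_mul, map_sub, PowerSeries.coeff_X_pow_mul', PowerSeries.coeff_mk,
    PowerSeries.coeff_mk, PowerSeries.coeff_mk, h j]
  ring

theorem mk_count34_mul :
    (1 - PowerSeries.X ^ 3) * ((1 - PowerSeries.X ^ 4) *
      PowerSeries.mk fun j => (count34 j : ℚ)) = 1 := by
  rw [one_sub_X_pow_mul_mk (g := fun j => if 3 ∣ j then 1 else 0),
    one_sub_X_pow_mul_mk (g := fun j => if j = 0 then 1 else 0)]
  · ext j
    simp [PowerSeries.coeff_one]
  · intro j
    rcases lt_or_ge j 3 with h | h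
    · interval_cases j <;> simp
    · obtain ⟨k, rfl⟩ := Nat.exists_eq_add_of_le' h
      simp
  · intro j
    rcases lt_or_ge j 4 with h | h
    · interval_cases j <;> norm_num [count34]
    · obtain ⟨k, rfl⟩ := Nat.exists_eq_add_of_le' h
      simp [count34_add_four]

theorem mk_count345_mul :
    ((1 - PowerSeries.X ^ 3) * (1 - PowerSeries.X ^ 4) * (1 - PowerSeries.X ^ 5)) *
      PowerSeries.mk (fun j => (count345 j : ℚ)) = 1 := by
  rw [mul_assoc, one_sub_X_pow_mul_mk (g := fun j => (count34 j : ℚ)), mul_assoc,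
    mk_count34_mul]
  intro j
  rcases lt_or_ge j 5 with h | h
  · have : count345 j = count34 j := by
      simp [count345, Nat.div_eq_of_lt h, Nat.mod_eq_of_lt h]
    simp [this, h.not_ge]
  · obtain ⟨k, rfl⟩ := Nat.exists_eq_add_of_le' h
    simp [count345_add_five]

theorem mk_count134_mul :
    ((1 - PowerSeries.X ^ 3) * (1 - PowerSeries.X ^ 4) * (1 - PowerSeries.X ^ 1)) *
      PowerSeries.mk (fun j => (count134 j : ℚ)) = 1 := by
  rw [mul_assoc, one_sub_X_pow_mul_mk (g := fun j => (count34 j : ℚ)), mul_assoc,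
    mk_count34_mul]
  intro j
  cases j with
  | zero => simp [count134]
  | succ k => simp [count134_add_one]

/-- The low coefficients of `∏_{i=1}^4 (1 - X ^ (n + i))` times a power series. -/
theorem coeff_prod_one_sub_mul_mk (f : ℕ → ℕ) {n j : ℕ} (hj : j ≤ 2 * n + 2) :
    PowerSeries.coeff j (((1 - PowerSeries.X ^ (n + 1)) * (1 - PowerSeries.X ^ (n + 2)) *
      (1 - PowerSeries.X ^ (n + 3)) * (1 - PowerSeries.X ^ (n + 4))) *
        PowerSeries.mk (fun j => (f j : ℚ))) =
      (f j : ℚ) - if n ≤ j then (sumFour f (j - n) : ℚ) else 0 := by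
  set F : ℚ⟦X⟧ := PowerSeries.mk (fun j => (f j : ℚ))
  -- Products of two or more of the monomials `X ^ (n + i)` have degree at least `2n + 3`, beyond
  -- `j`.
  have key : (((1 - PowerSeries.X ^ (n + 1)) * (1 - PowerSeries.X ^ (n + 2)) *
      (1 - PowerSeries.X ^ (n + 3)) * (1 - PowerSeries.X ^ (n + 4))) * F) =
      F - PowerSeries.X ^ (n + 1) * F - PowerSeries.X ^ (n + 2) * F -
        PowerSeries.X ^ (n + 3) * F - PowerSeries.X ^ (n + 4) * F +
        PowerSeries.X ^ (2 * n + 3) *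
          (((1 + PowerSeries.X + 2 * PowerSeries.X ^ 2 + PowerSeries.X ^ 3 + PowerSeries.X ^ 4) -
            PowerSeries.X ^ n * (PowerSeries.X ^ 3 + PowerSeries.X ^ 4 + PowerSeries.X ^ 5 +
              PowerSeries.X ^ 6) + PowerSeries.X ^ (2 * n) * PowerSeries.X ^ 7) * F) := by
    ring
  rw [key]
  simp only [map_add, map_sub, PowerSeries.coeff_X_pow_mul']
  rw [if_neg (show ¬ 2 * n + 3 ≤ j by omega)]
  simp only [F, PowerSeries.coeff_mk]
  rcases lt_or_ge j n with h | h
  · rw [if_neg (by omega), if_neg (by omega), if_neg (by omega), if_neg (by omega),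
      if_neg (by omega)]
    ring
  · obtain ⟨s, rfl⟩ := Nat.exists_eq_add_of_le h
    rw [if_pos h]
    have aux : ∀ i, 1 ≤ i → i ≤ 4 → (if n + i ≤ n + s then (f (n + s - (n + i)) : ℚ) else 0) =
        (shiftFour f (s + (4 - i)) : ℚ) := by
      intro i h1 h4
      unfold shiftFour
      by_cases hi : i ≤ s
      · rw [if_pos (by omega), if_neg (by omega), show n + s - (n + i) = s + (4 - i) - 4 by omega]
      · rw [if_neg (by omega), if_pos (by omega), Nat.cast_zero]
    rw [aux 1 (by norm_num) (by norm_num), aux 2 (by norm_num) (by norm_num),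
      aux 3 (by norm_num) (by norm_num), aux 4 (by norm_num) (by norm_num)]
    simp only [Nat.reduceSub, Nat.add_sub_cancel_left, sumFour, Finset.sum_range_succ, Finset.sum_range_zero]
    push_cast
    ring

end QCatalan

namespace QCatalan

open Polynomial in
/-- `P` is a nonzero palindromic polynomial of degree `2 h` whose coefficients `c j`, up to the middle
degree `h`, satisfy `c j - c (j - 2) ∈ ℕ`. -/
structure IsPalindromicIncreasing (P : ℚ[X]) (h : ℕ) : Prop where
  ne_zero : P ≠ 0
  natDegree_eq : P.natDegree = 2 * h
  reverse_eq : P.reverse = P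
  coeff_nat : ∀ j ≤ h, ∃ a : ℕ, ((1 - X ^ 2) * P).coeff j = (a : ℚ)

/-! ### Divisibility and symmetry of products of `X ^ k - 1` -/

section Polynomial

open Polynomial

/-- The polynomial `X ^ k - 1`. -/
noncomputable def powSubOne (k : ℕ) : ℚ[X] := X ^ k - 1

theorem powSubOne_monic {k : ℕ} (hk : k ≠ 0) : (powSubOne k).Monic :=
  monic_X_pow_sub_C 1 hk

theorem natDegree_powSubOne (k : ℕ) : (powSubOne k).natDegree = k :=
  natDegree_X_pow_sub_C (r := (1 : ℚ))

theorem reverse_powSubOne {k : ℕ} (hk : k ≠ 0) : (powSubOne k).reverse = -powSubOne k := by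
  ext j
  rw [coeff_reverse, natDegree_powSubOne]
  simp only [powSubOne, coeff_sub, coeff_neg, coeff_X_pow, coeff_one]
  rcases le_or_gt j k with h | h
  · rw [revAt_le h]
    rcases eq_or_ne j 0 with rfl | h0
    · simp [hk, hk.symm]
    · rcases eq_or_ne j k with rfl | h1
      · simp [hk, hk.symm]
      · have h2 : k - j ≠ k := by omega
        have h3 : k - j ≠ 0 := by omega
        simp [h0, h1, h2, h3]
  · rw [revAt_eq_self_of_lt h]
    have h0 : j ≠ k := by omega
    have h1 : j ≠ 0 := by omega
    simp [h0, h1]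

theorem powSubOne_eq_mul_sum (k : ℕ) :
    powSubOne k = powSubOne 1 * ∑ i ∈ Finset.range k, X ^ i := by
  rw [powSubOne, powSubOne, pow_one, mul_geom_sum]

/-- The product of `X ^ (n + i) - 1` for `1 ≤ i ≤ 4`. -/
noncomputable def fourPowSubOne (n : ℕ) : ℚ[X] :=
  powSubOne (n + 1) * powSubOne (n + 2) * powSubOne (n + 3) * powSubOne (n + 4)

theorem cyclotomic_dvd_prod_geom_sum {d n : ℕ} (hd : d ≠ 1) {i : ℕ} (hi : i ∈ Finset.Icc 1 4)
    (h : d ∣ n + i) :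
    cyclotomic d ℚ ∣ ∏ i ∈ Finset.Icc 1 4, ∑ k ∈ Finset.range (n + i), (X : ℚ[X]) ^ k :=
  (cyclotomic_dvd_geom_sum_of_dvd ℚ h hd).trans
    (Finset.dvd_prod_of_mem (fun i => ∑ k ∈ Finset.range (n + i), (X : ℚ[X]) ^ k) hi)

/-- Two of the four consecutive exponents are even, and each contributes one factor `cyclotomic 2
ℚ`. -/
theorem cyclotomic_two_sq_dvd_prod_geom_sum (n : ℕ) :
    cyclotomic 2 ℚ ^ 2 ∣ ∏ i ∈ Finset.Icc 1 4, ∑ k ∈ Finset.range (n + i), (X : ℚ[X]) ^ k := by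
  have key : ∀ i, 2 ∣ n + i → cyclotomic 2 ℚ ∣ ∑ k ∈ Finset.range (n + i), (X : ℚ[X]) ^ k :=
    fun i hi => cyclotomic_dvd_geom_sum_of_dvd ℚ hi (by norm_num)
  rw [show Finset.Icc 1 4 = {1, 2, 3, 4} by decide]
  rw [Finset.prod_insert (by decide), Finset.prod_insert (by decide),
    Finset.prod_insert (by decide), Finset.prod_singleton, sq]
  rcases Nat.even_or_odd' n with ⟨m, rfl | rfl⟩
  · exact Dvd.dvd.mul_left (mul_dvd_mul (key 2 (by omega))
      (Dvd.dvd.mul_left (key 4 (by omega)) _)) _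
  · exact mul_dvd_mul (key 1 (by omega))
      (Dvd.dvd.mul_left (Dvd.dvd.mul_right (key 3 (by omega)) _) _)

theorem cyclotomic_prod_dvd_prod_geom_sum (n : ℕ) :
    cyclotomic 2 ℚ ^ 2 * cyclotomic 3 ℚ * cyclotomic 4 ℚ ∣
      ∏ i ∈ Finset.Icc 1 4, ∑ k ∈ Finset.range (n + i), (X : ℚ[X]) ^ k := by
  have h3 : ∃ i ∈ Finset.Icc 1 4, 3 ∣ n + i :=
    ⟨3 - n % 3, by simp only [Finset.mem_Icc]; omega, by omega⟩
  have h4 : ∃ i ∈ Finset.Icc 1 4, 4 ∣ n + i :=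
    ⟨4 - n % 4, by simp only [Finset.mem_Icc]; omega, by omega⟩
  obtain ⟨i, hi, hi'⟩ := h3
  obtain ⟨j, hj, hj'⟩ := h4
  have c23 : IsCoprime (cyclotomic 2 ℚ ^ 2) (cyclotomic 3 ℚ) :=
    (cyclotomic.isCoprime_rat (by norm_num)).pow_left
  have c24 : IsCoprime (cyclotomic 2 ℚ ^ 2) (cyclotomic 4 ℚ) :=
    (cyclotomic.isCoprime_rat (by norm_num)).pow_left
  have c34 : IsCoprime (cyclotomic 3 ℚ) (cyclotomic 4 ℚ) :=
    cyclotomic.isCoprime_rat (by norm_num)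
  exact (c24.mul_left c34).mul_dvd
    (c23.mul_dvd (cyclotomic_two_sq_dvd_prod_geom_sum n)
      (cyclotomic_dvd_prod_geom_sum (by norm_num) hi hi'))
    (cyclotomic_dvd_prod_geom_sum (by norm_num) hj hj')

theorem cyclotomic_prod_dvd_prod_geom_sum_of_not_dvd {n : ℕ} (hn : ¬ 5 ∣ n) :
    cyclotomic 2 ℚ ^ 2 * cyclotomic 3 ℚ * cyclotomic 4 ℚ * cyclotomic 5 ℚ ∣
      ∏ i ∈ Finset.Icc 1 4, ∑ k ∈ Finset.range (n + i), (X : ℚ[X]) ^ k := by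
  have h5 : ∃ i ∈ Finset.Icc 1 4, 5 ∣ n + i :=
    ⟨5 - n % 5, by simp only [Finset.mem_Icc]; omega, by omega⟩
  obtain ⟨i, hi, hi'⟩ := h5
  have c25 : IsCoprime (cyclotomic 2 ℚ ^ 2) (cyclotomic 5 ℚ) :=
    (cyclotomic.isCoprime_rat (by norm_num)).pow_left
  have c35 : IsCoprime (cyclotomic 3 ℚ) (cyclotomic 5 ℚ) :=
    cyclotomic.isCoprime_rat (by norm_num)
  have c45 : IsCoprime (cyclotomic 4 ℚ) (cyclotomic 5 ℚ) :=
    cyclotomic.isCoprime_rat (by norm_num)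
  exact ((c25.mul_left c35).mul_left c45).mul_dvd (cyclotomic_prod_dvd_prod_geom_sum n)
    (cyclotomic_dvd_prod_geom_sum (by norm_num) hi hi')

theorem fourPowSubOne_eq_mul_prod_geom_sum (n : ℕ) :
    fourPowSubOne n = powSubOne 1 ^ 4 *
      ∏ i ∈ Finset.Icc 1 4, ∑ k ∈ Finset.range (n + i), (X : ℚ[X]) ^ k := by
  rw [show Finset.Icc 1 4 = {1, 2, 3, 4} by decide]
  rw [Finset.prod_insert (by decide), Finset.prod_insert (by decide),
    Finset.prod_insert (by decide), Finset.prod_singleton, fourPowSubOne,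
    powSubOne_eq_mul_sum (n + 1), powSubOne_eq_mul_sum (n + 2), powSubOne_eq_mul_sum (n + 3),
    powSubOne_eq_mul_sum (n + 4)]
  ring

theorem cyclotomic_four_rat : cyclotomic 4 ℚ = X ^ 2 + 1 := by
  rw [show 4 = 2 ^ (1 + 1) by norm_num, cyclotomic_prime_pow_eq_geom_sum Nat.prime_two]
  simp [Finset.sum_range_succ, add_comm]

theorem fourPowSubOne_one_eq :
    fourPowSubOne 1 = powSubOne 1 ^ 4 *
      (cyclotomic 2 ℚ ^ 2 * cyclotomic 3 ℚ * cyclotomic 4 ℚ * cyclotomic 5 ℚ) := by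
  have := Fact.mk Nat.prime_five
  rw [cyclotomic_four_rat, cyclotomic_prime ℚ 5, cyclotomic_two, cyclotomic_three]
  simp only [fourPowSubOne, powSubOne, Finset.sum_range_succ, Finset.sum_range_zero]
  ring

theorem fourPowSubOne_zero_eq :
    fourPowSubOne 0 = powSubOne 1 ^ 4 *
      (cyclotomic 2 ℚ ^ 2 * cyclotomic 3 ℚ * cyclotomic 4 ℚ) := by
  rw [cyclotomic_four_rat, cyclotomic_two, cyclotomic_three]
  simp only [fourPowSubOne, powSubOne]
  ring

theorem fourPowSubOne_one_dvd {n : ℕ} (hn : ¬ 5 ∣ n) : fourPowSubOne 1 ∣ fourPowSubOne n := by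
  rw [fourPowSubOne_one_eq, fourPowSubOne_eq_mul_prod_geom_sum n]
  exact mul_dvd_mul_left _ (cyclotomic_prod_dvd_prod_geom_sum_of_not_dvd hn)

theorem fourPowSubOne_zero_dvd (n : ℕ) : fourPowSubOne 0 ∣ fourPowSubOne n := by
  rw [fourPowSubOne_zero_eq, fourPowSubOne_eq_mul_prod_geom_sum n]
  exact mul_dvd_mul_left _ (cyclotomic_prod_dvd_prod_geom_sum n)

theorem fourPowSubOne_monic (n : ℕ) : (fourPowSubOne n).Monic :=
  (((powSubOne_monic (by omega)).mul (powSubOne_monic (by omega))).mul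
    (powSubOne_monic (by omega))).mul (powSubOne_monic (by omega))

theorem natDegree_fourPowSubOne (n : ℕ) : (fourPowSubOne n).natDegree = 4 * n + 10 := by
  unfold fourPowSubOne
  have h := fun i (hi : i ≠ 0) => (powSubOne_monic hi).ne_zero
  rw [natDegree_mul (mul_ne_zero (mul_ne_zero (h _ (by omega)) (h _ (by omega))) (h _ (by omega)))
      (h _ (by omega)),
    natDegree_mul (mul_ne_zero (h _ (by omega)) (h _ (by omega))) (h _ (by omega)),
    natDegree_mul (h _ (by omega)) (h _ (by omega))]
  simp only [natDegree_powSubOne]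
  ring

theorem reverse_fourPowSubOne (n : ℕ) : (fourPowSubOne n).reverse = fourPowSubOne n := by
  unfold fourPowSubOne
  simp only [reverse_mul_of_domain]
  rw [reverse_powSubOne (by omega), reverse_powSubOne (by omega), reverse_powSubOne (by omega),
    reverse_powSubOne (by omega)]
  ring

/-- Reversal is multiplicative and fixes both four-fold products, so it fixes their quotient. -/
theorem reverse_eq_of_mul_fourPowSubOne {P : ℚ[X]} {m n : ℕ}
    (h : P * fourPowSubOne m = fourPowSubOne n) : P.reverse = P := by
  have h1 := congrArg reverse h
  rw [reverse_mul_of_domain, reverse_fourPowSubOne, reverse_fourPowSubOne, ← h] at h1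
  exact mul_right_cancel₀ (fourPowSubOne_monic m).ne_zero h1

theorem ne_zero_of_mul_fourPowSubOne {P : ℚ[X]} {m n : ℕ}
    (h : P * fourPowSubOne m = fourPowSubOne n) : P ≠ 0 := by
  rintro rfl
  exact (fourPowSubOne_monic n).ne_zero (by rw [← h, zero_mul])

theorem natDegree_eq_of_mul_fourPowSubOne {P : ℚ[X]} {m n : ℕ}
    (h : P * fourPowSubOne m = fourPowSubOne n) : P.natDegree + 4 * m = 4 * n := by
  have hP := ne_zero_of_mul_fourPowSubOne h
  have h1 := congrArg natDegree h
  rw [natDegree_mul hP (fourPowSubOne_monic m).ne_zero, natDegree_fourPowSubOne,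
    natDegree_fourPowSubOne] at h1
  omega

/-! ### Coefficients up to the middle degree -/

theorem coeff_eq_of_mul_prod_one_sub {P D : ℚ[X]} {n j : ℕ} {f : ℕ → ℕ}
    (h : P * D = (1 - X ^ (n + 1)) * (1 - X ^ (n + 2)) * (1 - X ^ (n + 3)) * (1 - X ^ (n + 4)))
    (hf : (D : ℚ⟦X⟧) * PowerSeries.mk (fun j => (f j : ℚ)) = 1) (hj : j ≤ 2 * n + 2) :
    P.coeff j = (f j : ℚ) - if n ≤ j then (sumFour f (j - n) : ℚ) else 0 := by
  rw [← coeff_prod_one_sub_mul_mk f hj, ← Polynomial.coeff_coe P]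
  congr 1
  have h1 := congrArg (fun Q : ℚ[X] => (Q : ℚ⟦X⟧)) h
  simp only [Polynomial.coe_mul, Polynomial.coe_sub, Polynomial.coe_pow, Polynomial.coe_X,
    Polynomial.coe_one] at h1
  rw [← h1, mul_assoc, hf, mul_one]

theorem exists_nat_eq_sub_sumFour {f : ℕ → ℕ} {n j : ℕ}
    (h : n ≤ j → sumFour f (j - n) ≤ f j) :
    ∃ a : ℕ, (f j : ℚ) - (if n ≤ j then (sumFour f (j - n) : ℚ) else 0) = a := by
  by_cases hj : n ≤ j
  · exact ⟨f j - sumFour f (j - n), by rw [if_pos hj, Nat.cast_sub (h hj)]⟩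
  · exact ⟨f j, by rw [if_neg hj, sub_zero]⟩

theorem isPalindromicIncreasing_of_not_dvd {P : ℚ[X]} {n : ℕ} (hn : ¬ 5 ∣ n)
    (h : P * fourPowSubOne 1 = fourPowSubOne n) : IsPalindromicIncreasing P (2 * n - 2) := by
  have hd := natDegree_eq_of_mul_fourPowSubOne h
  have hn0 : n ≠ 0 := by rintro rfl; exact hn (dvd_zero 5)
  refine ⟨ne_zero_of_mul_fourPowSubOne h, by omega, reverse_eq_of_mul_fourPowSubOne h, fun j hj => ?_⟩
  have h1 : ((1 - X ^ 2) * P) * ((1 - X ^ 3) * (1 - X ^ 4) * (1 - X ^ 5)) =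
      (1 - X ^ (n + 1)) * (1 - X ^ (n + 2)) * (1 - X ^ (n + 3)) * (1 - X ^ (n + 4)) := by
    simp only [fourPowSubOne, powSubOne] at h
    norm_num at h
    linear_combination h
  rw [coeff_eq_of_mul_prod_one_sub (f := count345) h1
    (by simpa using mk_count345_mul) (by omega)]
  refine exists_nat_eq_sub_sumFour fun hnj => ?_
  -- Here `u = 2n - 2 - j`, the distance to the middle degree.
  obtain ⟨u, hu⟩ : ∃ u, j = 2 * (j - n) + 2 + u := ⟨j - (2 * (j - n) + 2), by omega⟩
  conv_rhs => rw [hu]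
  exact sumFour_count345_le _ _

theorem isPalindromicIncreasing_of_mul_fourPowSubOne_zero {P : ℚ[X]} {n : ℕ}
    (h : P * fourPowSubOne 0 = fourPowSubOne n) : IsPalindromicIncreasing P (2 * n) := by
  have hd := natDegree_eq_of_mul_fourPowSubOne h
  refine ⟨ne_zero_of_mul_fourPowSubOne h, by omega, reverse_eq_of_mul_fourPowSubOne h, fun j hj => ?_⟩
  have h1 : ((1 - X ^ 2) * P) * ((1 - X ^ 3) * (1 - X ^ 4) * (1 - X ^ 1)) =
      (1 - X ^ (n + 1)) * (1 - X ^ (n + 2)) * (1 - X ^ (n + 3)) * (1 - X ^ (n + 4)) := by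
    simp only [fourPowSubOne, powSubOne] at h
    norm_num at h
    linear_combination h
  rw [coeff_eq_of_mul_prod_one_sub (f := count134) h1
    (by simpa using mk_count134_mul) (by omega)]
  refine exists_nat_eq_sub_sumFour fun hnj => ?_
  obtain ⟨u, hu⟩ : ∃ u, j = 2 * (j - n) + u := ⟨j - 2 * (j - n), by omega⟩
  conv_rhs => rw [hu]
  exact sumFour_count134_le _ _

/-! ### Parity unimodality -/

namespace IsPalindromicIncreasing

variable {P : ℚ[X]} {h : ℕ}

theorem coeff_symm (hP : IsPalindromicIncreasing P h) {j : ℕ} (hj : j ≤ 2 * h) :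
    P.coeff (2 * h - j) = P.coeff j := by
  have := congrArg (fun Q => coeff Q j) hP.reverse_eq
  rwa [coeff_reverse, hP.natDegree_eq, revAt_le hj] at this

theorem coeff_sub_coeff (hP : IsPalindromicIncreasing P h) {j : ℕ} (hj : j + 2 ≤ h) :
    ∃ a : ℕ, P.coeff (j + 2) = P.coeff j + a := by
  obtain ⟨a, ha⟩ := hP.coeff_nat (j + 2) hj
  refine ⟨a, ?_⟩
  rw [sub_mul, one_mul, coeff_sub, coeff_X_pow_mul] at ha
  rw [← ha]; ring

theorem coeff_eq_nat_of_le (hP : IsPalindromicIncreasing P h) (j : ℕ) (hj : j ≤ h) :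
    ∃ a : ℕ, P.coeff j = a := by
  induction j using Nat.strong_induction_on with
  | _ j ih =>
    rcases lt_or_ge j 2 with h2 | h2
    · obtain ⟨a, ha⟩ := hP.coeff_nat j hj
      refine ⟨a, ?_⟩
      rwa [sub_mul, one_mul, coeff_sub, coeff_X_pow_mul', if_neg (by omega), sub_zero] at ha
    · obtain ⟨k, rfl⟩ := Nat.exists_eq_add_of_le' h2
      obtain ⟨a, ha⟩ := ih k (by omega) (by omega)
      obtain ⟨b, hb⟩ := hP.coeff_sub_coeff hj
      exact ⟨a + b, by rw [hb, ha]; push_cast; rfl⟩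

theorem coeff_eq_nat (hP : IsPalindromicIncreasing P h) (j : ℕ) : ∃ a : ℕ, P.coeff j = a := by
  rcases le_or_gt j h with hj | hj
  · exact hP.coeff_eq_nat_of_le j hj
  · rcases le_or_gt j (2 * h) with hj' | hj'
    · obtain ⟨a, ha⟩ := hP.coeff_eq_nat_of_le (2 * h - j) (by omega)
      exact ⟨a, by rw [← ha, hP.coeff_symm hj']⟩
    · exact ⟨0, by rw [coeff_eq_zero_of_natDegree_lt (by rw [hP.natDegree_eq]; exact hj'),
        Nat.cast_zero]⟩

theorem exists_nat_polynomial (hP : IsPalindromicIncreasing P h) :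
    ∃ p : ℕ[X], p.map (Nat.castRingHom ℚ) = P := by
  choose a ha using hP.coeff_eq_nat
  refine ⟨∑ j ∈ Finset.range (2 * h + 1), monomial j (a j), ?_⟩
  rw [Polynomial.map_sum]
  conv_rhs => rw [P.as_sum_range, hP.natDegree_eq]
  refine Finset.sum_congr rfl fun j _ => ?_
  rw [map_monomial, ha]
  rfl

theorem coeff_le_coeff_add_two (hP : IsPalindromicIncreasing P h) {j : ℕ} (hj : j + 2 ≤ h) :
    P.coeff j ≤ P.coeff (j + 2) := by
  obtain ⟨a, ha⟩ := hP.coeff_sub_coeff hj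
  rw [ha]
  exact le_add_of_nonneg_right a.cast_nonneg

theorem coeff_add_two_le_coeff (hP : IsPalindromicIncreasing P h) {j : ℕ} (hj : h ≤ j + 1)
    (hj' : j + 2 ≤ 2 * h) : P.coeff (j + 2) ≤ P.coeff j := by
  rw [← hP.coeff_symm hj', ← hP.coeff_symm (show j ≤ 2 * h by omega)]
  rcases eq_or_lt_of_le hj with h1 | h1
  -- If `h = j + 1`, the indices `j` and `j + 2` are mirror images and the coefficients agree.
  · rw [hP.coeff_symm (by omega), show 2 * h - j = j + 2 by omega]
  · rw [show 2 * h - j = 2 * h - (j + 2) + 2 by omega]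
    exact hP.coeff_le_coeff_add_two (by omega)

theorem isParityUnimodal (hP : IsPalindromicIncreasing P h) {p : ℕ[X]}
    (hp : p.map (Nat.castRingHom ℚ) = P) : IsParityUnimodal p := by
  have hc : ∀ j, P.coeff j = p.coeff j := fun j => by rw [← hp, coeff_map]; rfl
  have hdeg : p.natDegree = 2 * h := by
    rw [← hP.natDegree_eq, ← hp, natDegree_map_eq_of_injective]
    exact Nat.cast_injective
  have up : ∀ j, j + 2 ≤ h → p.coeff j ≤ p.coeff (j + 2) := fun j hj => by
    have := hP.coeff_le_coeff_add_two hj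
    rw [hc, hc] at this
    exact_mod_cast this
  have down : ∀ j, h ≤ j + 1 → j + 2 ≤ 2 * h → p.coeff (j + 2) ≤ p.coeff j :=
    fun j hj hj' => by
      have := hP.coeff_add_two_le_coeff hj hj'
      rw [hc, hc] at this
      exact_mod_cast this
  rw [IsParityUnimodal, hdeg]
  refine ⟨⟨h / 2, fun i hi => ⟨fun hk => up (2 * i) (by omega),
    fun hk => down (2 * i) (by omega) (by omega)⟩⟩,
    ⟨(h - 1) / 2, fun i hi => ⟨fun hk => up (2 * i + 1) (by omega),
    fun hk => down (2 * i + 1) (by omega) (by omega)⟩⟩⟩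

end IsPalindromicIncreasing

end Polynomial

end QCatalan

namespace QCatalan

/-! ### Rational functions -/

section RationalFunction

open Polynomial

theorem algebraMap_powSubOne (k : ℕ) :
    algebraMap ℚ[X] (RatFunc ℚ) (powSubOne k) = q ^ k - 1 := by
  simp [powSubOne, q]

theorem q_pow_sub_one_ne_zero {k : ℕ} (hk : k ≠ 0) : q ^ k - 1 ≠ 0 := by
  rw [← algebraMap_powSubOne]
  exact RatFunc.algebraMap_ne_zero (powSubOne_monic hk).ne_zero

theorem q_ne_zero : q ≠ 0 := RatFunc.X_ne_zero

theorem qNum_eq (k : ℕ) : qNum k = (q ^ k - 1) / (q - 1) := by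
  rw [qNum, ← neg_sub, ← neg_sub q, neg_div_neg_eq]

theorem q_sub_one_ne_zero : q - 1 ≠ 0 := by
  simpa using q_pow_sub_one_ne_zero one_ne_zero

theorem qNum_ne_zero {k : ℕ} (hk : k ≠ 0) : qNum k ≠ 0 := by
  rw [qNum_eq]
  exact div_ne_zero (q_pow_sub_one_ne_zero hk) q_sub_one_ne_zero

theorem qNum_one : qNum 1 = 1 := by
  rw [qNum_eq, pow_one, div_self q_sub_one_ne_zero]

theorem qFact_succ (n : ℕ) : qFact (n + 1) = qFact n * qNum (n + 1) := by
  rw [qFact, qFact, Finset.prod_Icc_succ_top (by omega)]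

theorem qFact_ne_zero (n : ℕ) : qFact n ≠ 0 :=
  Finset.prod_ne_zero_iff.mpr fun i hi => qNum_ne_zero (by have := Finset.mem_Icc.mp hi; omega)

theorem ratCatalan_five_mul (n : ℕ) :
    ratCatalan 5 n * (qNum 2 * qNum 3 * qNum 4 * qNum 5) =
      qNum (n + 1) * qNum (n + 2) * qNum (n + 3) * qNum (n + 4) := by
  have h1 := qFact_ne_zero n
  have h5 : qFact 5 = qNum 2 * qNum 3 * qNum 4 * qNum 5 := by
    simp [qFact_succ, qNum_one, show qFact 0 = 1 by simp [qFact]]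
  have h5' := qFact_ne_zero 5
  have hn := qNum_ne_zero (show n + 5 ≠ 0 by omega)
  rw [← h5, ratCatalan, gauss, add_comm 5 n]
  rw [qFact_succ, qFact_succ, qFact_succ, qFact_succ, qFact_succ]
  field_simp

theorem algebraMap_fourPowSubOne (n : ℕ) :
    algebraMap ℚ[X] (RatFunc ℚ) (fourPowSubOne n) =
      (qNum (n + 1) * qNum (n + 2) * qNum (n + 3) * qNum (n + 4)) * (q - 1) ^ 4 := by
  have := q_sub_one_ne_zero
  simp only [fourPowSubOne, map_mul, algebraMap_powSubOne, qNum_eq]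
  field_simp

theorem algebraMap_fourPowSubOne_ne_zero (n : ℕ) :
    algebraMap ℚ[X] (RatFunc ℚ) (fourPowSubOne n) ≠ 0 :=
  RatFunc.algebraMap_ne_zero (fourPowSubOne_monic n).ne_zero

theorem ratCatalan_five_mul_fourPowSubOne (n : ℕ) :
    ratCatalan 5 n * algebraMap ℚ[X] (RatFunc ℚ) (fourPowSubOne 1) =
      algebraMap ℚ[X] (RatFunc ℚ) (fourPowSubOne n) := by
  rw [algebraMap_fourPowSubOne n, ← ratCatalan_five_mul, algebraMap_fourPowSubOne]
  ring_nf

theorem qNum_five_mul_ratCatalan_mul_fourPowSubOne (n : ℕ) :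
    qNum 5 * ratCatalan 5 n * algebraMap ℚ[X] (RatFunc ℚ) (fourPowSubOne 0) =
      algebraMap ℚ[X] (RatFunc ℚ) (fourPowSubOne n) := by
  rw [algebraMap_fourPowSubOne n, ← ratCatalan_five_mul, algebraMap_fourPowSubOne]
  simp only [zero_add, qNum_one]
  ring

theorem ratCatalan_five_ne_zero (n : ℕ) : ratCatalan 5 n ≠ 0 := fun h =>
  algebraMap_fourPowSubOne_ne_zero n
    (by rw [← ratCatalan_five_mul_fourPowSubOne, h, zero_mul])

/-- `[gcd(5, n)] C_{5,n}(q)` is a polynomial, palindromic and increasing by steps of two up to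
the middle degree. -/
theorem exists_isPalindromicIncreasing (n : ℕ) :
    ∃ (P : ℚ[X]) (h : ℕ), IsPalindromicIncreasing P h ∧
      algebraMap ℚ[X] (RatFunc ℚ) P = qNum (Nat.gcd 5 n) * ratCatalan 5 n := by
  -- The case `n = 0`, needed for the constant term in `x`, falls under `5 ∣ n`: there `[5] C_{5,0}
  -- = 1`.
  by_cases hn : 5 ∣ n
  · obtain ⟨P, hP⟩ := fourPowSubOne_zero_dvd n
    rw [mul_comm] at hP
    refine ⟨P, 2 * n, isPalindromicIncreasing_of_mul_fourPowSubOne_zero hP.symm, ?_⟩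
    apply mul_right_cancel₀ (algebraMap_fourPowSubOne_ne_zero 0)
    rw [Nat.gcd_eq_left hn, qNum_five_mul_ratCatalan_mul_fourPowSubOne, hP, map_mul]
  · obtain ⟨P, hP⟩ := fourPowSubOne_one_dvd hn
    rw [mul_comm] at hP
    refine ⟨P, 2 * n - 2, isPalindromicIncreasing_of_not_dvd hn hP.symm, ?_⟩
    apply mul_right_cancel₀ (algebraMap_fourPowSubOne_ne_zero 1)
    rw [(Nat.prime_five.coprime_iff_not_dvd.mpr hn).gcd_eq_one, qNum_one, one_mul,
      ratCatalan_five_mul_fourPowSubOne, hP, map_mul]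

/-! ### Normalization -/

theorem eval₂_q_sq (P : ℚ[X]) :
    P.eval₂ (RatFunc.C : ℚ →+* RatFunc ℚ) (q ^ 2) =
      algebraMap ℚ[X] (RatFunc ℚ) (expand ℚ 2 P) := by
  rw [expand_eq_sum, eval₂_eq_sum, Polynomial.sum, Polynomial.sum, map_sum]
  simp [q]

theorem eval₂_q_sq_ne_zero {P : ℚ[X]} (hP : P ≠ 0) :
    P.eval₂ (RatFunc.C : ℚ →+* RatFunc ℚ) (q ^ 2) ≠ 0 := by
  rw [eval₂_q_sq]
  exact RatFunc.algebraMap_ne_zero ((expand_ne_zero (by norm_num)).mpr hP)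

/-- No nonzero denominator vanishes at `q ^ 2`, so evaluation is multiplicative, while degrees of
nonzero functions add. -/
theorem normalization_mul {f g : RatFunc ℚ} (hf : f ≠ 0) (hg : g ≠ 0) :
    normalization (f * g) = normalization f * normalization g := by
  rw [normalization, normalization, normalization,
    RatFunc.eval_mul _ _ (eval₂_q_sq_ne_zero f.denom_ne_zero)
      (eval₂_q_sq_ne_zero g.denom_ne_zero), RatFunc.intDegree_mul hf hg, neg_add,
    zpow_add₀ q_ne_zero]
  ring

theorem normalization_algebraMap (P : ℚ[X]) :
    normalization (algebraMap ℚ[X] (RatFunc ℚ) P) =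
      algebraMap ℚ[X] (RatFunc ℚ) (expand ℚ 2 P) * q ^ (-(P.natDegree : ℤ)) := by
  rw [normalization, RatFunc.eval_algebraMap, RatFunc.intDegree_polynomial,
    Algebra.algebraMap_self, RingHom.id_apply, eval₂_q_sq]

theorem normalization_powSubOne (k : ℕ) :
    normalization (algebraMap ℚ[X] (RatFunc ℚ) (powSubOne k)) = q ^ k - q ^ (-(k : ℤ)) := by
  rw [normalization_algebraMap, natDegree_powSubOne]
  have : algebraMap ℚ[X] (RatFunc ℚ) (expand ℚ 2 (powSubOne k)) = q ^ k * q ^ k - 1 := by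
    simp [powSubOne, q, ← pow_mul, ← pow_add, two_mul]
  rw [this, sub_mul, one_mul, zpow_neg, zpow_natCast, mul_assoc,
    mul_inv_cancel₀ (pow_ne_zero k q_ne_zero), mul_one]

/-- This lets the prefactor of `H` be absorbed into the normalization of `[d] C_{5,n}`. -/
theorem normalization_qNum {d : ℕ} (hd : d ≠ 0) : normalization (qNum d) = symNum d := by
  have h1 : q - q ^ (-1 : ℤ) ≠ 0 := by
    intro h
    apply q_pow_sub_one_ne_zero two_ne_zero
    rw [sub_eq_zero, zpow_neg_one] at h
    rw [sub_eq_zero, sq]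
    nth_rewrite 1 [h]
    exact inv_mul_cancel₀ q_ne_zero
  have h2 := normalization_mul (qNum_ne_zero hd) q_sub_one_ne_zero
  have h3 : q - 1 = algebraMap ℚ[X] (RatFunc ℚ) (powSubOne 1) := by
    rw [algebraMap_powSubOne, pow_one]
  rw [qNum_eq, div_mul_cancel₀ _ q_sub_one_ne_zero, ← qNum_eq, h3, normalization_powSubOne,
    ← algebraMap_powSubOne, normalization_powSubOne, pow_one, Nat.cast_one] at h2
  rw [symNum, eq_div_iff h1, h2]

theorem symNum_mul_normalization_ratCatalan {P : ℚ[X]} {h n : ℕ}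
    (hP : IsPalindromicIncreasing P h)
    (hn : algebraMap ℚ[X] (RatFunc ℚ) P = qNum (Nat.gcd 5 n) * ratCatalan 5 n) :
    symNum (Nat.gcd 5 n) * ((q ^ 2 - q ^ (-2 : ℤ)) * normalization (ratCatalan 5 n)) =
      q ^ (-((2 * h + 2 : ℕ) : ℤ)) *
        algebraMap ℚ[X] (RatFunc ℚ) (expand ℚ 2 ((X ^ 2 - 1) * P)) := by
  have hd : Nat.gcd 5 n ≠ 0 := Nat.gcd_ne_zero_left (by norm_num)
  rw [← normalization_qNum hd, mul_left_comm,
    ← normalization_mul (qNum_ne_zero hd) (ratCatalan_five_ne_zero n), ← hn,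
    normalization_algebraMap, hP.natDegree_eq, map_mul, map_mul, Nat.cast_add, neg_add,
    zpow_add₀ q_ne_zero]
  have : algebraMap ℚ[X] (RatFunc ℚ) (expand ℚ 2 (X ^ 2 - 1)) = q ^ 2 * q ^ 2 - 1 := by
    simp only [map_sub, map_pow, map_one, expand_X, RatFunc.algebraMap_X, q]
    ring
  rw [this]
  have h2 := q_ne_zero
  have h3 : q ^ 2 - q ^ (-2 : ℤ) = q ^ (-((2 : ℕ) : ℤ)) * (q ^ 2 * q ^ 2 - 1) := by
    rw [zpow_neg, zpow_neg, zpow_natCast, show (2 : ℤ) = ((2 : ℕ) : ℤ) by rfl, zpow_natCast]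
    field_simp
  rw [h3]
  ring

/-! ### Laurent expansions -/

theorem expansion_mul (f g : RatFunc ℚ) : expansion (f * g) = expansion f * expansion g :=
  map_mul _ f g

theorem coeff_expansion_algebraMap (Q : ℚ[X]) (i : ℤ) :
    (expansion (algebraMap ℚ[X] (RatFunc ℚ) Q)).coeff i =
      if i < 0 then 0 else Q.coeff i.natAbs := by
  have : expansion (algebraMap ℚ[X] (RatFunc ℚ) Q) = ((Q : ℚ⟦X⟧) : ℚ⸨X⸩) :=
    (RatFunc.coe_coe Q).symm
  rw [this, PowerSeries.coeff_coe, Polynomial.coeff_coe]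

theorem coeff_expansion_zpow_mul (N : ℕ) (Q : ℚ[X]) (i : ℤ) :
    (expansion (q ^ (-(N : ℤ)) * algebraMap ℚ[X] (RatFunc ℚ) Q)).coeff i =
      if i + N < 0 then 0 else Q.coeff (i + N).natAbs := by
  have : expansion (q ^ (-(N : ℤ))) = HahnSeries.single (-(N : ℤ)) 1 := by
    rw [expansion, map_zpow₀, q, RatFunc.coe_X, ← RatFunc.single_zpow]
  rw [expansion_mul, this, ← coeff_expansion_algebraMap]
  have h := HahnSeries.coeff_single_mul_add (r := (1 : ℚ))
    (x := expansion (algebraMap ℚ[X] (RatFunc ℚ) Q)) (a := i + N) (b := -(N : ℤ))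
  rw [add_neg_cancel_right, one_mul] at h
  exact h

/-! ### Antisymmetry and positive parts -/

namespace IsPalindromicIncreasing

variable {P : ℚ[X]} {h : ℕ}

theorem natDegree_mul_eq (hP : IsPalindromicIncreasing P h) :
    ((X ^ 2 - 1) * P).natDegree = 2 * h + 2 := by
  have h2 : (X ^ 2 - 1 : ℚ[X]).natDegree = 2 := natDegree_powSubOne 2
  have h3 : (X ^ 2 - 1 : ℚ[X]) ≠ 0 := (powSubOne_monic two_ne_zero).ne_zero
  rw [natDegree_mul h3 hP.ne_zero, h2, hP.natDegree_eq, add_comm]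

theorem coeff_mul_antisymm (hP : IsPalindromicIncreasing P h) {j : ℕ} (hj : j ≤ 2 * h + 2) :
    ((X ^ 2 - 1) * P).coeff (2 * h + 2 - j) = -((X ^ 2 - 1) * P).coeff j := by
  have h1 : ((X ^ 2 - 1) * P).reverse = -((X ^ 2 - 1) * P) := by
    have h2 : (X ^ 2 - 1 : ℚ[X]).reverse = -(X ^ 2 - 1) := reverse_powSubOne two_ne_zero
    rw [reverse_mul_of_domain, h2, hP.reverse_eq, neg_mul]
  have := congrArg (fun Q => coeff Q j) h1
  rwa [coeff_reverse, hP.natDegree_mul_eq, revAt_le hj, coeff_neg] at this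

theorem coeff_expand_antisymm (hP : IsPalindromicIncreasing P h) {j : ℕ}
    (hj : j ≤ 2 * (2 * h + 2)) :
    (expand ℚ 2 ((X ^ 2 - 1) * P)).coeff (2 * (2 * h + 2) - j) =
      -(expand ℚ 2 ((X ^ 2 - 1) * P)).coeff j := by
  rw [coeff_expand two_pos, coeff_expand two_pos]
  by_cases h2 : 2 ∣ j
  · obtain ⟨k, rfl⟩ := h2
    rw [if_pos (by omega), if_pos (by omega), ← Nat.mul_sub, Nat.mul_div_cancel_left _ two_pos,
      Nat.mul_div_cancel_left _ two_pos, hP.coeff_mul_antisymm (by omega)]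
  · rw [if_neg (by omega), if_neg h2, neg_zero]

theorem coeff_expand_eq_zero (hP : IsPalindromicIncreasing P h) {j : ℕ}
    (hj : 2 * (2 * h + 2) < j) : (expand ℚ 2 ((X ^ 2 - 1) * P)).coeff j = 0 := by
  apply coeff_eq_zero_of_natDegree_lt
  rw [natDegree_expand, hP.natDegree_mul_eq]
  omega

/-- Antisymmetry carries a coefficient above the middle to one of `(1 - X ^ 2) * P` in degree at
most `h`. -/
theorem coeff_expand_eq_nat (hP : IsPalindromicIncreasing P h) {j : ℕ} (hj : 2 * h + 2 < j) :
    ∃ a : ℕ, (expand ℚ 2 ((X ^ 2 - 1) * P)).coeff j = a := by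
  rcases lt_or_ge (2 * (2 * h + 2)) j with h1 | h1
  · exact ⟨0, by rw [hP.coeff_expand_eq_zero h1, Nat.cast_zero]⟩
  · rw [coeff_expand two_pos]
    by_cases h2 : 2 ∣ j
    · obtain ⟨k, rfl⟩ := h2
      obtain ⟨a, ha⟩ := hP.coeff_nat (2 * h + 2 - k) (by omega)
      refine ⟨a, ?_⟩
      rw [if_pos (by omega), Nat.mul_div_cancel_left _ two_pos, ← ha, ← neg_sub (X ^ 2), neg_mul,
        coeff_neg, hP.coeff_mul_antisymm (by omega), neg_neg]
    · exact ⟨0, by rw [if_neg h2, Nat.cast_zero]⟩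

theorem posPart_expansion_eq (hP : IsPalindromicIncreasing P h) :
    posPart (expansion (q ^ (-((2 * h + 2 : ℕ) : ℤ)) *
        algebraMap ℚ[X] (RatFunc ℚ) (expand ℚ 2 ((X ^ 2 - 1) * P)))) =
      posPart' (expansion (q ^ (-((2 * h + 2 : ℕ) : ℤ)) *
        algebraMap ℚ[X] (RatFunc ℚ) (expand ℚ 2 ((X ^ 2 - 1) * P)))) := by
  ext i
  simp only [posPart, posPart']
  by_cases hi : 0 < i
  · rw [if_pos hi, if_pos hi, coeff_expansion_zpow_mul, coeff_expansion_zpow_mul,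
      if_neg (by omega)]
    by_cases h1 : -i + ((2 * h + 2 : ℕ) : ℤ) < 0
    · rw [if_pos h1, neg_zero, hP.coeff_expand_eq_zero (by omega)]
    · rw [if_neg h1, ← hP.coeff_expand_antisymm (by omega)]
      congr 1
      omega
  · rw [if_neg hi, if_neg hi]

theorem exists_posPart_expansion_eq (hP : IsPalindromicIncreasing P h) :
    ∃ p : ℕ[X], posPart (expansion (q ^ (-((2 * h + 2 : ℕ) : ℤ)) *
        algebraMap ℚ[X] (RatFunc ℚ) (expand ℚ 2 ((X ^ 2 - 1) * P)))) =
      expansion (ofNatPoly p) := by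
  -- The condition sits inside the existential so that `choose` yields a function on all of `ℕ`; `j
  -- = 0` is the exponent 0, which `posPart` discards.
  have : ∀ j : ℕ, ∃ a : ℕ, j ≠ 0 →
      (expand ℚ 2 ((X ^ 2 - 1) * P)).coeff (j + (2 * h + 2)) = a := by
    intro j
    by_cases hj : j = 0
    · exact ⟨0, fun h0 => absurd hj h0⟩
    · obtain ⟨a, ha⟩ := hP.coeff_expand_eq_nat (j := j + (2 * h + 2)) (by omega)
      exact ⟨a, fun _ => ha⟩
  choose a ha using this
  refine ⟨∑ j ∈ Finset.Icc 1 (2 * h + 2), monomial j (a j), ?_⟩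
  ext i
  rw [ofNatPoly, coeff_expansion_algebraMap, coeff_map, finsetSum_coeff]
  simp only [posPart, coeff_monomial, Finset.sum_ite_eq', Finset.mem_Icc]
  rw [coeff_expansion_zpow_mul]
  rcases lt_trichotomy i 0 with hi | rfl | hi
  · rw [if_neg (by omega), if_pos hi]
  · simp
  · rw [if_pos hi, if_neg (by omega), if_neg (by omega)]
    have h1 : (i + ((2 * h + 2 : ℕ) : ℤ)).natAbs = i.natAbs + (2 * h + 2) := by omega
    rw [h1]
    by_cases h2 : i.natAbs ≤ 2 * h + 2
    · rw [if_pos ⟨by omega, h2⟩, ha _ (by omega)]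
      rfl
    · rw [if_neg (by omega), hP.coeff_expand_eq_zero (by omega), map_zero]

end IsPalindromicIncreasing

end RationalFunction

/-! ### The theorem -/

theorem PT_extract (m r : ℕ) (G : PowerSeries ℚ⸨X⸩) : PT (extract m r G) = extract m r (PT G) := by
  ext1 k
  simp only [PT, extract, PowerSeries.coeff_mk]

theorem PT'_extract (m r : ℕ) (G : PowerSeries ℚ⸨X⸩) :
    PT' (extract m r G) = extract m r (PT' G) := by
  ext1 k
  simp only [PT', extract, PowerSeries.coeff_mk]

theorem coeff_extract_genH (r k : ℕ) :
    ∃ (P : ℚ[X]) (h : ℕ), IsPalindromicIncreasing P h ∧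
      PowerSeries.coeff k (extract 5 r (genH 5 (Nat.gcd 5 r))) =
        expansion (q ^ (-((2 * h + 2 : ℕ) : ℤ)) *
          algebraMap ℚ[X] (RatFunc ℚ)
            (Polynomial.expand ℚ 2 ((Polynomial.X ^ 2 - 1) * P))) := by
  obtain ⟨P, h, hP, hn⟩ := exists_isPalindromicIncreasing (k * 5 + r)
  refine ⟨P, h, hP, ?_⟩
  -- A single prefactor serves the whole residue class of `r`.
  have hg : Nat.gcd 5 (k * 5 + r) = Nat.gcd 5 r := by simp
  rw [← symNum_mul_normalization_ratCatalan hP hn, extract, PowerSeries.coeff_mk, genH,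
    PowerSeries.coeff_C_mul, genF, PowerSeries.coeff_mk, hg,
    ← expansion_mul]

theorem exists_isParityUnimodal (n : ℕ) :
    ∃ p : ℕ[X], ofNatPoly p = qNum (Nat.gcd 5 n) * ratCatalan 5 n ∧ IsParityUnimodal p := by
  obtain ⟨P, h, hP, hn⟩ := exists_isPalindromicIncreasing n
  obtain ⟨p, hp⟩ := hP.exists_nat_polynomial
  exact ⟨p, by rw [ofNatPoly, hp, hn], hP.isParityUnimodal hp⟩

end QCatalan

theorem proposition9 :
    (∀ r : ℕ, r < 5 →
      QCatalan.PT (QCatalan.extract 5 r (QCatalan.genH 5 (Nat.gcd 5 r)))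
          = QCatalan.extract 5 r (QCatalan.PT (QCatalan.genH 5 (Nat.gcd 5 r))) ∧
        QCatalan.PT' (QCatalan.extract 5 r (QCatalan.genH 5 (Nat.gcd 5 r)))
          = QCatalan.extract 5 r (QCatalan.PT' (QCatalan.genH 5 (Nat.gcd 5 r))) ∧
        QCatalan.PT (QCatalan.extract 5 r (QCatalan.genH 5 (Nat.gcd 5 r)))
          = QCatalan.PT' (QCatalan.extract 5 r (QCatalan.genH 5 (Nat.gcd 5 r))) ∧
        QCatalan.HasNatPolyCoeffs
          (QCatalan.PT (QCatalan.extract 5 r (QCatalan.genH 5 (Nat.gcd 5 r))))) ∧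
      (∀ n : ℕ, 1 ≤ n → ∃ p : Polynomial ℕ,
        QCatalan.ofNatPoly p = QCatalan.qNum (Nat.gcd 5 n) * QCatalan.ratCatalan 5 n ∧
          QCatalan.IsParityUnimodal p) ∧
      (∀ n : ℕ, 1 ≤ n → Nat.Coprime 5 n → ∃ p : Polynomial ℕ,
        QCatalan.ofNatPoly p = QCatalan.ratCatalan 5 n ∧ QCatalan.IsParityUnimodal p) := by
  refine ⟨fun r _ => ⟨QCatalan.PT_extract _ _ _, QCatalan.PT'_extract _ _ _, ?_, fun k => ?_⟩,
    fun n _ => QCatalan.exists_isParityUnimodal n, fun n _ hn => ?_⟩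
  · ext1 k
    obtain ⟨P, h, hP, hk⟩ := QCatalan.coeff_extract_genH r k
    rw [QCatalan.PT, QCatalan.PT', PowerSeries.coeff_mk, PowerSeries.coeff_mk, hk,
      hP.posPart_expansion_eq]
  · obtain ⟨P, h, hP, hk⟩ := QCatalan.coeff_extract_genH r k
    rw [QCatalan.PT, PowerSeries.coeff_mk, hk]
    exact hP.exists_posPart_expansion_eq
  · obtain ⟨p, hp⟩ := QCatalan.exists_isParityUnimodal n
    rw [hn.gcd_eq_one, QCatalan.qNum_one, one_mul] at hp
    exact ⟨p, hp⟩
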